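/- Let $R_1$ and $R_2$ be discrete valuation domains with maximal ideals $P_1$ and $P_2$, let $\overline{R}$ be a field, and let $v_1\colon R_1\to\overline{R}$ and $v_2\colon R_2\to\overline{R}$ be surjective ring homomorphisms. Let $R=\{(r_1,r_2)\in R_1\times R_2 : v_1(r_1)=v_2(r_2)\}$ be the pullback ring. Definitions. A proper ideal $I$ of a commutative ring $A$ is *2-absorbing primary* if $abc\in I$ implies $ab\in I$ or $ac\in\sqrt{I}$ or $bc\in\sqrt{I}$, for all $a,b,c\in A$. A proper submodule $N$ of an $A$-module $M$ is *pseudo-absorbing primary* if $(N:_A M)=\{r\in A : rM\subseteq N\}$ is a 2-absorbing primary ideal, and $M$ is a *pseudo-absorbing primary multiplication module* if every pseudo-absorbing primary submodule $N$ of $M$ is of the form $N=IM$ for some ideal $I$ of $A$. A non-zero module is *indecomposable* if it is not a direct sum of two non-zero submodules. An $R$-module $S$ is *separated* if it is isomorphic to an $R$-submodule of $S_1\oplus S_2$ for some $R_1$-module $S_1$ and some $R_2$-module $S_2$, where $R$ acts by $(r_1,r_2)(s_1,s_2)=(r_1s_1,r_2s_2)$. For an $R_1$-module $S_1$ and an $R_2$-module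 $S_2$ with additive maps $f_i\colon S_i\to\overline{R}$ satisfying $f_i(rs)=v_i(r)f_i(s)$ for all $r\in R_i$ and $s\in S_i$, let $(S_1\to\overline{R}\leftarrow S_2)$ denote the $R$-module $\{(s_1,s_2)\in S_1\oplus S_2 : f_1(s_1)=f_2(s_2)\}$. Below, the map $R_i\to\overline{R}$ is $v_i$, and the map $R_i/P_i^n\to\overline{R}$ ($n\ge 1$) is the one induced by $v_i$. **Theorem.** Every non-zero indecomposable separated pseudo-absorbing primary multiplication $R$-module is isomorphic to one of the following $R$-modules: 1. $R$; 2. $(R_1/P_1^n\to\overline{R}\leftarrow R_2/P_2^m)$ for some $n,m\ge 1$; 3. $(R_1\to\overline{R}\leftarrow R_2/P_2^m)$ for some $m\ge 1$; 4. $(R_1/P_1^n\to\overline{R}\leftarrow R_2)$ for some $n\ge 1$. Conversely, for all $n,m\ge 1$, each of these $R$-modules is non-zero, indecomposable, separated and a pseudo-absorbing primary multiplication module. -/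

import Mathlib

universe u₁ u₂ u₃ u₄ u₅ u₆ u v

/-! ### Pseudo-absorbing primary multiplication modules -/

/-- A proper ideal `I` is 2-absorbing primary if `abc ∈ I` implies
`ab ∈ I` or `ac ∈ √I` or `bc ∈ √I`. -/
def IsTwoAbsorbingPrimary {A : Type u} [CommRing A] (I : Ideal A) : Prop :=
  I ≠ ⊤ ∧ ∀ a b c : A, a * b * c ∈ I → a * b ∈ I ∨ a * c ∈ I.radical ∨ b * c ∈ I.radical

/-- A proper submodule `N` of `M` is pseudo-absorbing primary if the ideal
`(N : M) = {r | r M ⊆ N}` is 2-absorbing primary. -/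
def IsPseudoAbsorbingPrimary {A : Type u} [CommRing A] {M : Type v} [AddCommGroup M] [Module A M]
    (N : Submodule A M) : Prop :=
  N ≠ ⊤ ∧ IsTwoAbsorbingPrimary (N.colon Set.univ)

/-- `M` is pseudo-absorbing primary multiplication if every pseudo-absorbing primary submodule
is of the form `I M` for some ideal `I`. -/
def IsPseudoAbsorbingPrimaryMultiplication (A : Type u) [CommRing A] (M : Type v)
    [AddCommGroup M] [Module A M] : Prop :=
  ∀ N : Submodule A M, IsPseudoAbsorbingPrimary N → ∃ I : Ideal A, N = I • (⊤ : Submodule A M)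

/-- A module is indecomposable if it is non-zero and is not the internal direct sum of two
non-zero submodules. -/
def IsIndecomposableModule (A : Type u) [CommRing A] (M : Type v)
    [AddCommGroup M] [Module A M] : Prop :=
  Nontrivial M ∧ ∀ N L : Submodule A M, IsCompl N L → N = ⊥ ∨ L = ⊥

/-! ### Modules over a pullback ring

`RingHom.pullback v₁ v₂` is the ring of pairs `(r₁, r₂)` with `v₁ r₁ = v₂ r₂`. -/

section Pullback

variable {R₁ : Type u₁} {R₂ : Type u₂} {k : Type u₃} [CommRing R₁] [CommRing R₂] [Field k]
  (v₁ : R₁ →+* k) (v₂ : R₂ →+* k)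

/-- A module `S` over the pullback ring is separated if it is isomorphic to a submodule of
`S₁ × S₂` for some `R₁`-module `S₁` and some `R₂`-module `S₂`, where the pullback ring acts by
`(r₁, r₂) • (s₁, s₂) = (r₁ • s₁, r₂ • s₂)`. -/
def IsSeparatedModule (S : Type v) [AddCommGroup S] [Module (RingHom.pullback v₁ v₂) S] : Prop :=
  ∃ (S₁ : Type v) (S₂ : Type v) (_ : AddCommGroup S₁) (_ : AddCommGroup S₂)
    (_ : Module R₁ S₁) (_ : Module R₂ S₂) (f : S →+ S₁ × S₂),
    Function.Injective f ∧
      ∀ (r : RingHom.pullback v₁ v₂) (s : S),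
        f (r • s) = (r.1.1 • (f s).1, r.1.2 • (f s).2)

variable {v₁ v₂}

/-- The set of pairs `(s₁, s₂)` with `f₁ s₁ = f₂ s₂`, for an `R₁`-module `S₁`, an `R₂`-module
`S₂`, a `k`-vector space `T` and maps `f₁ : S₁ → T`, `f₂ : S₂ → T` which are semilinear over
`v₁` and `v₂`. -/
def pullbackAddSubgroup {S₁ : Type u₄} {S₂ : Type u₅} {T : Type u₆}
    [AddCommGroup S₁] [AddCommGroup S₂] [AddCommGroup T] [Module R₁ S₁] [Module R₂ S₂] [Module k T]
    (f₁ : S₁ →ₛₗ[v₁] T) (f₂ : S₂ →ₛₗ[v₂] T) : AddSubgroup (S₁ × S₂) where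
  carrier := {s | f₁ s.1 = f₂ s.2}
  zero_mem' := by
    change f₁ 0 = f₂ 0
    rw [map_zero, map_zero]
  add_mem' := by
    intro a b ha hb
    change f₁ a.1 = f₂ a.2 at ha
    change f₁ b.1 = f₂ b.2 at hb
    change f₁ (a.1 + b.1) = f₂ (a.2 + b.2)
    rw [map_add, map_add, ha, hb]
  neg_mem' := by
    intro a ha
    change f₁ a.1 = f₂ a.2 at ha
    change f₁ (-a.1) = f₂ (-a.2)
    rw [map_neg, map_neg, ha]

/-- The module `(S₁ → T ← S₂)`. -/
def PullbackModule {S₁ : Type u₄} {S₂ : Type u₅} {T : Type u₆}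
    [AddCommGroup S₁] [AddCommGroup S₂] [AddCommGroup T] [Module R₁ S₁] [Module R₂ S₂] [Module k T]
    (f₁ : S₁ →ₛₗ[v₁] T) (f₂ : S₂ →ₛₗ[v₂] T) : Type (max u₄ u₅) :=
  pullbackAddSubgroup f₁ f₂

instance PullbackModule.instAddCommGroup {S₁ : Type u₄} {S₂ : Type u₅} {T : Type u₆}
    [AddCommGroup S₁] [AddCommGroup S₂] [AddCommGroup T] [Module R₁ S₁] [Module R₂ S₂] [Module k T]
    (f₁ : S₁ →ₛₗ[v₁] T) (f₂ : S₂ →ₛₗ[v₂] T) : AddCommGroup (PullbackModule f₁ f₂) :=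
  inferInstanceAs (AddCommGroup (pullbackAddSubgroup f₁ f₂))

/-- The pullback ring acts on `(S₁ → T ← S₂)` componentwise. -/
instance PullbackModule.instModule {S₁ : Type u₄} {S₂ : Type u₅} {T : Type u₆}
    [AddCommGroup S₁] [AddCommGroup S₂] [AddCommGroup T] [Module R₁ S₁] [Module R₂ S₂] [Module k T]
    (f₁ : S₁ →ₛₗ[v₁] T) (f₂ : S₂ →ₛₗ[v₂] T) :
    Module (RingHom.pullback v₁ v₂) (PullbackModule f₁ f₂) where
  smul r s := ⟨(r.1.1 • s.1.1, r.1.2 • s.1.2), by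
    have hr : v₁ r.1.1 = v₂ r.1.2 := r.2
    have hs : f₁ s.1.1 = f₂ s.1.2 := s.2
    change f₁ (r.1.1 • s.1.1) = f₂ (r.1.2 • s.1.2)
    rw [map_smulₛₗ, map_smulₛₗ, hr, hs]⟩
  one_smul s := Subtype.ext (Prod.ext (one_smul R₁ s.1.1) (one_smul R₂ s.1.2))
  mul_smul a b s :=
    Subtype.ext (Prod.ext (mul_smul a.1.1 b.1.1 s.1.1) (mul_smul a.1.2 b.1.2 s.1.2))
  smul_zero a := Subtype.ext (Prod.ext (smul_zero a.1.1) (smul_zero a.1.2))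
  smul_add a s t :=
    Subtype.ext (Prod.ext (smul_add a.1.1 s.1.1 t.1.1) (smul_add a.1.2 s.1.2 t.1.2))
  add_smul a b s :=
    Subtype.ext (Prod.ext (add_smul a.1.1 b.1.1 s.1.1) (add_smul a.1.2 b.1.2 s.1.2))
  zero_smul s := Subtype.ext (Prod.ext (zero_smul R₁ s.1.1) (zero_smul R₂ s.1.2))

end Pullback

/-! ### The maps `A → k` and `A / Pⁿ → k` for a local ring `A` with maximal ideal `P` -/

section Residue

variable {A : Type u} {k : Type v} [CommRing A] [Field k]

/-- The ring homomorphism `v : A → k`, viewed as a `v`-semilinear map. -/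
def semilinearOfRingHom (v : A →+* k) : A →ₛₗ[v] k where
  toFun := v
  map_add' := map_add v
  map_smul' a b := by simp

theorem maximalIdeal_pow_le_ker [IsLocalRing A] (v : A →+* k) (hv : Function.Surjective v)
    {n : ℕ} (hn : 1 ≤ n) :
    IsLocalRing.maximalIdeal A ^ n ≤ LinearMap.ker (semilinearOfRingHom v) := by
  have hmax : (RingHom.ker v).IsMaximal := RingHom.ker_isMaximal_of_surjective v hv
  have hker : RingHom.ker v = IsLocalRing.maximalIdeal A := IsLocalRing.eq_maximalIdeal hmax
  intro x hx
  have hx' : x ∈ RingHom.ker v := hker ▸ Ideal.pow_le_self (by omega) hx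
  exact hx'

/-- The map `A / Pⁿ → k`, `n ≥ 1`, induced by a surjection `v : A → k`. -/
def residueMap [IsLocalRing A] (v : A →+* k) (hv : Function.Surjective v) (n : ℕ) (hn : 1 ≤ n) :
    (A ⧸ IsLocalRing.maximalIdeal A ^ n) →ₛₗ[v] k :=
  Submodule.liftQ (IsLocalRing.maximalIdeal A ^ n) (semilinearOfRingHom v)
    (maximalIdeal_pow_le_ker v hv hn)

end Residue

/-!
The pullback ring `R` is local. If `ϖ₁`, `ϖ₂` are uniformizers of `R₁`, `R₂`, its maximal ideal is
`P = (e, e')` with `e = (ϖ₁, 0)` and `e' = (0, ϖ₂)`; the ideals `(e)` and `(e')` are prime and meet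
in zero, and if the component of `r` in `R₁` is non-zero, then `r e` is a unit times a positive
power of `e`.

A pseudo-absorbing primary multiplication module `M ≠ 0` over `R` is cyclic
(`exists_span_singleton_eq_top`). If `N` is a proper submodule with `N + P M = M`, then `T = M / N`
satisfies `e T = e² T` and `e' T = e'² T`, so `(N : M)` is one of `(e)`, `(e')`, `0`, each of which
is an intersection of two primes and hence 2-absorbing primary
(`isPseudoAbsorbingPrimary_of_sup_eq_top`). So `N = I M` for some ideal `I`. If `P M = M`, this
applies to every proper cyclic submodule and gives `P (R x) = P I M = I M = R x`, so that `x = 0` by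
Nakayama. Otherwise take `x ∉ P M`. An ideal `I` with `x ∈ I M` is not contained in `P`, so `I M =
M`. Proper submodules containing `P M` have colon ideal `P`, which is prime, so `R x + P M` is of
the form `I M` and equals `M`; then `R x` is of the form `I M` and equals `M`.

In a separated module the annihilator of `x ≠ 0` is the set of pairs in `R` with components in
given proper ideals `J₁`, `J₂` (`IsSeparatedModule.exists_smul_eq_zero_iff`), each zero or a power
of the maximal ideal. The four combinations are the annihilators of `(1, 1)` in the modules of the
list, which it generates. Conversely, cyclic modules are multiplication modules, and over a local
ring they are indecomposable.
-/

/-! ### 2-absorbing primary ideals -/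

theorem isTwoAbsorbingPrimary_inf {A : Type u} [CommRing A] {p q : Ideal A}
    (hp : p.IsPrime) (hq : q.IsPrime) : IsTwoAbsorbingPrimary (p ⊓ q) := by
  refine ⟨fun h => hp.ne_top (top_le_iff.1 (h ▸ inf_le_left)), fun a b c habc => ?_⟩
  have h₁ := hp.mem_or_mem habc.1
  have h₂ := hq.mem_or_mem habc.2
  rw [hp.mul_mem_iff_mem_or_mem] at h₁
  rw [hq.mul_mem_iff_mem_or_mem] at h₂
  have hrad : p ⊓ q ≤ (p ⊓ q).radical := Ideal.le_radical
  suffices h : a * b ∈ p ⊓ q ∨ a * c ∈ p ⊓ q ∨ b * c ∈ p ⊓ q from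
    h.imp_right (Or.imp (fun h => hrad h) (fun h => hrad h))
  simp only [Ideal.mem_inf, hp.mul_mem_iff_mem_or_mem, hq.mul_mem_iff_mem_or_mem]
  tauto

theorem Ideal.IsPrime.isTwoAbsorbingPrimary {A : Type u} [CommRing A] {p : Ideal A}
    (hp : p.IsPrime) : IsTwoAbsorbingPrimary p := by
  simpa using isTwoAbsorbingPrimary_inf hp hp

/-! ### Cyclic modules -/

section Cyclic

variable {A : Type u} [CommRing A] {M : Type v} [AddCommGroup M] [Module A M]

/-- In a cyclic module every submodule `N` equals `(N : M) M`. -/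
theorem isPseudoAbsorbingPrimaryMultiplication_of_span_singleton {x : M}
    (hx : Submodule.span A {x} = ⊤) : IsPseudoAbsorbingPrimaryMultiplication A M := by
  refine fun N _ => ⟨N.colon Set.univ, le_antisymm (fun y hy => ?_) ?_⟩
  · obtain ⟨a, rfl⟩ := Submodule.mem_span_singleton.1 (hx ▸ Submodule.mem_top : y ∈ A ∙ x)
    refine Submodule.smul_mem_smul (Submodule.mem_colon.2 fun z _ => ?_) Submodule.mem_top
    obtain ⟨b, rfl⟩ := Submodule.mem_span_singleton.1 (hx ▸ Submodule.mem_top : z ∈ A ∙ x)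
    rw [smul_comm]
    exact N.smul_mem b hy
  · exact Submodule.smul_le.2 fun r hr z _ => Submodule.mem_colon.1 hr z (Set.mem_univ z)

/-- If a generator `x` is `a x + b x` with `a x`, `b x` in two complementary submodules, then `a`,
`b` or `1 - (a + b)` is a unit, which puts `x` in the first submodule, in the second one, or makes
it zero. -/
theorem isIndecomposableModule_of_span_singleton [IsLocalRing A] {x : M}
    (hx : Submodule.span A {x} = ⊤) (hx0 : x ≠ 0) : IsIndecomposableModule A M := by
  refine ⟨⟨x, 0, hx0⟩, fun N L hNL => ?_⟩
  have key : ∀ N : Submodule A M, x ∈ N → N = ⊤ := fun N h =>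
    top_le_iff.1 (hx ▸ (Submodule.span_singleton_le_iff_mem x N).2 h)
  obtain ⟨n, hn, l, hl, hnl⟩ := Submodule.mem_sup.1
    (hNL.sup_eq_top ▸ Submodule.mem_top : x ∈ N ⊔ L)
  obtain ⟨a, rfl⟩ := Submodule.mem_span_singleton.1 (hx ▸ Submodule.mem_top : n ∈ A ∙ x)
  obtain ⟨b, rfl⟩ := Submodule.mem_span_singleton.1 (hx ▸ Submodule.mem_top : l ∈ A ∙ x)
  have hab : (1 - (a + b)) • x = 0 := by rw [sub_smul, add_smul, hnl, one_smul, sub_self]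
  rcases IsLocalRing.isUnit_or_isUnit_of_isUnit_add
    (show IsUnit ((1 - (a + b)) + (a + b)) by simp) with h | h
  · exact absurd (h.smul_eq_zero.1 hab) hx0
  · rcases IsLocalRing.isUnit_or_isUnit_of_isUnit_add h with h | h
    · refine Or.inr (top_disjoint.1 ?_)
      exact key N ((N.smul_mem_iff_of_isUnit h).1 hn) ▸ hNL.disjoint
    · refine Or.inl (disjoint_top.1 ?_)
      exact key L ((L.smul_mem_iff_of_isUnit h).1 hl) ▸ hNL.disjoint

/-- Cyclic modules whose generators have the same annihilator are isomorphic. -/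
theorem nonempty_linearEquiv_of_span_singleton {M' : Type*} [AddCommGroup M'] [Module A M']
    {x : M} {y : M'} (hx : Submodule.span A {x} = ⊤) (hy : Submodule.span A {y} = ⊤)
    (h : ∀ r : A, r • x = 0 ↔ r • y = 0) : Nonempty (M ≃ₗ[A] M') := by
  have hker : LinearMap.ker (LinearMap.toSpanSingleton A M x) =
      LinearMap.ker (LinearMap.toSpanSingleton A M' y) := by
    ext r
    simpa using h r
  exact ⟨((LinearMap.toSpanSingleton A M x).quotKerEquivOfSurjective
      (LinearMap.range_eq_top.1 (by rw [LinearMap.range_toSpanSingleton, hx]))).symm ≪≫ₗ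
    Submodule.quotEquivOfEq _ _ hker ≪≫ₗ
    (LinearMap.toSpanSingleton A M' y).quotKerEquivOfSurjective
      (LinearMap.range_eq_top.1 (by rw [LinearMap.range_toSpanSingleton, hy]))⟩

end Cyclic

/-! ### Multiplication modules over a local ring with two orthogonal parameters -/

section TwoParameters

variable {A : Type u} [CommRing A] {M : Type v} [AddCommGroup M] [Module A M]

/-- On a quotient `T = M / N` with `T = e T + e' T` and `e e' = 0`, one has `e T = e² T`, so no
power of `e` kills `T` unless `e` does. -/
theorem mem_colon_univ_of_pow_mem {N : Submodule A M} {e e' : A} (hee' : e * e' = 0)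
    (hN : N ⊔ Ideal.span {e, e'} • (⊤ : Submodule A M) = ⊤) (n : ℕ)
    (h : e ^ (n + 1) ∈ N.colon Set.univ) : e ∈ N.colon Set.univ := by
  induction n with
  | zero => simpa using h
  | succ n ih =>
    refine ih (Submodule.mem_colon.2 fun s _ => ?_)
    have hs : s ∈ N ⊔ Ideal.span {e, e'} • (⊤ : Submodule A M) := by
      rw [hN]
      exact Submodule.mem_top
    rw [Ideal.span_insert, Submodule.sup_smul, Submodule.ideal_span_singleton_smul,
      Submodule.ideal_span_singleton_smul] at hs
    obtain ⟨t, ht, z, hz, rfl⟩ := Submodule.mem_sup.1 hs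
    obtain ⟨y, hy, y', hy', rfl⟩ := Submodule.mem_sup.1 hz
    obtain ⟨a, -, rfl⟩ := (Submodule.mem_smul_pointwise_iff_exists _ _ _).1 hy
    obtain ⟨b, -, rfl⟩ := (Submodule.mem_smul_pointwise_iff_exists _ _ _).1 hy'
    have ha : e ^ (n + 1) • e • a ∈ N := by
      rw [smul_smul, ← pow_succ]
      exact Submodule.mem_colon.1 h a (Set.mem_univ a)
    have hb : e ^ (n + 1) • e' • b = 0 := by
      rw [smul_smul, pow_succ, mul_assoc, hee', mul_zero, zero_smul]
    rw [smul_add, smul_add, hb, add_zero]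
    exact N.add_mem (N.smul_mem _ ht) ha

theorem colon_univ_le_of_notMem {N : Submodule A M} {e e' : A} (hee' : e * e' = 0)
    (hN : N ⊔ Ideal.span {e, e'} • (⊤ : Submodule A M) = ⊤)
    (hA : ∀ r : A, r ∉ Ideal.span {e'} → ∃ n : ℕ, Associated (r * e) (e ^ (n + 1)))
    (he : e ∉ N.colon Set.univ) : N.colon Set.univ ≤ Ideal.span {e'} := by
  intro r hr
  by_contra hr'
  obtain ⟨n, hn⟩ := hA r hr'
  exact he (mem_colon_univ_of_pow_mem hee' hN n
    (Ideal.mem_of_dvd _ hn.dvd (Ideal.mul_mem_right e _ hr)))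

variable {e e' : A} (he : (Ideal.span {e}).IsPrime) (he' : (Ideal.span {e'}).IsPrime)
  (hinf : Ideal.span {e} ⊓ Ideal.span {e'} = ⊥)
  (hA : ∀ r : A, r ∉ Ideal.span {e'} → ∃ n : ℕ, Associated (r * e) (e ^ (n + 1)))
  (hA' : ∀ r : A, r ∉ Ideal.span {e} → ∃ n : ℕ, Associated (r * e') (e' ^ (n + 1)))
include he he' hinf hA hA'

/-- A proper submodule `N` with `N + (e, e') M = M` has `(N : M)` equal to `(e)`, `(e')` or
`0 = (e) ∩ (e')`, according to which of `e`, `e'` kill `M / N`. -/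
theorem isPseudoAbsorbingPrimary_of_sup_eq_top {N : Submodule A M} (hN' : N ≠ ⊤)
    (hN : N ⊔ Ideal.span {e, e'} • (⊤ : Submodule A M) = ⊤) : IsPseudoAbsorbingPrimary N := by
  refine ⟨hN', ?_⟩
  have hee' : e * e' = 0 := by
    rw [← Ideal.mem_bot, ← hinf]
    exact ⟨Ideal.mul_mem_right _ _ (Ideal.mem_span_singleton_self e),
      Ideal.mul_mem_left _ _ (Ideal.mem_span_singleton_self e')⟩
  have h₁ := colon_univ_le_of_notMem hee' hN hA
  have h₂ := colon_univ_le_of_notMem (mul_comm e' e ▸ hee') (Set.pair_comm e e' ▸ hN) hA'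
  by_cases h : e ∈ N.colon Set.univ <;> by_cases h' : e' ∈ N.colon Set.univ
  · refine absurd ?_ hN'
    rw [← hN, left_eq_sup]
    refine Submodule.smul_le.2 fun r hr s _ => ?_
    have hle : Ideal.span {e, e'} ≤ N.colon Set.univ :=
      Ideal.span_le.2 (Set.insert_subset h (Set.singleton_subset_iff.2 h'))
    exact Submodule.mem_colon.1 (hle hr) s (Set.mem_univ s)
  · rw [le_antisymm (h₂ h') ((Ideal.span_singleton_le_iff_mem _).2 h)]
    exact he.isTwoAbsorbingPrimary
  · rw [le_antisymm (h₁ h) ((Ideal.span_singleton_le_iff_mem _).2 h')]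
    exact he'.isTwoAbsorbingPrimary
  · have : N.colon Set.univ = Ideal.span {e} ⊓ Ideal.span {e'} :=
      le_antisymm (le_inf (h₂ h') (h₁ h)) (hinf ▸ bot_le)
    rw [this]
    exact isTwoAbsorbingPrimary_inf he he'

/-- A non-zero pseudo-absorbing primary multiplication module over a local ring with maximal ideal
`(e, e')` is cyclic. -/
theorem exists_span_singleton_eq_top [IsLocalRing A] [Nontrivial M]
    (hmax : IsLocalRing.maximalIdeal A = Ideal.span {e, e'})
    (hM : IsPseudoAbsorbingPrimaryMultiplication A M) :
    ∃ x : M, x ≠ 0 ∧ Submodule.span A {x} = ⊤ := by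
  set P := IsLocalRing.maximalIdeal A with hP
  have hsup : ∀ N : Submodule A M, N ⊔ P • (⊤ : Submodule A M) = ⊤ →
      ∃ I : Ideal A, N = I • (⊤ : Submodule A M) := by
    intro N hN
    by_cases hN' : N = ⊤
    · exact ⟨⊤, by rw [hN', Submodule.top_smul]⟩
    · exact hM N (isPseudoAbsorbingPrimary_of_sup_eq_top he he' hinf hA hA' hN' (hmax ▸ hN))
  by_cases hPM : P • (⊤ : Submodule A M) = ⊤
  · -- Every cyclic submodule is `A x = I M`, so `P (A x) = I (P M) = A x`, and `x = 0` by Nakayama.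
    obtain ⟨x, hx⟩ := exists_ne (0 : M)
    obtain ⟨I, hI⟩ := hsup (Submodule.span A {x}) (by rw [hPM, sup_top_eq])
    refine absurd ((Submodule.span_singleton_eq_bot (R := A)).1 ?_) hx
    refine Submodule.eq_bot_of_le_smul_of_le_jacobson_bot P _ (Submodule.fg_span_singleton x) ?_
      (IsLocalRing.jacobson_eq_maximalIdeal ⊥ bot_ne_top).ge
    rw [hI, ← mul_smul, mul_comm, mul_smul, hPM]
  · have hI : ∀ I : Ideal A, ¬ I • (⊤ : Submodule A M) ≤ P • (⊤ : Submodule A M) →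
        I • (⊤ : Submodule A M) = ⊤ := by
      intro I h
      have : I = ⊤ := by
        by_contra hI
        exact h (Submodule.smul_mono_left (IsLocalRing.le_maximalIdeal hI))
      rw [this, Submodule.top_smul]
    obtain ⟨x, -, hx⟩ := SetLike.exists_of_lt (lt_top_iff_ne_top.2 hPM)
    have hxN : ∀ N : Submodule A M, x ∈ N → ∀ I : Ideal A, N = I • (⊤ : Submodule A M) → N = ⊤ := by
      rintro N hxN I rfl
      exact hI I fun hle => hx (hle hxN)
    have hx' : Submodule.span A {x} ⊔ P • (⊤ : Submodule A M) = ⊤ := by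
      by_contra hne
      have hcolon : P = (Submodule.span A {x} ⊔ P • (⊤ : Submodule A M)).colon Set.univ := by
        refine (IsLocalRing.maximalIdeal.isMaximal A).eq_of_le (fun h => hne ?_) fun r hr => ?_
        · rw [Submodule.colon_eq_top_iff_subset] at h
          exact top_le_iff.1 fun y _ => h (Set.mem_univ y)
        · exact Submodule.mem_colon.2 fun s _ =>
            Submodule.mem_sup_right (Submodule.smul_mem_smul hr Submodule.mem_top)
      obtain ⟨I, h⟩ := hM _ ⟨hne, hcolon ▸
        (IsLocalRing.maximalIdeal.isMaximal A).isPrime.isTwoAbsorbingPrimary⟩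
      exact hne (hxN _ (Submodule.mem_sup_left (Submodule.mem_span_singleton_self x)) I h)
    obtain ⟨I, h⟩ := hsup _ hx'
    refine ⟨x, ?_, hxN _ (Submodule.mem_span_singleton_self x) I h⟩
    rintro rfl
    exact hx (Submodule.zero_mem _)

end TwoParameters

/-! ### Ideals and residue maps of a discrete valuation ring -/

theorem map_eq_zero_iff_mem_maximalIdeal {A : Type u} {k : Type v} [CommRing A] [IsLocalRing A]
    [Field k] (f : A →+* k) (hf : Function.Surjective f) (a : A) :
    f a = 0 ↔ a ∈ IsLocalRing.maximalIdeal A := by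
  rw [← RingHom.mem_ker, IsLocalRing.eq_maximalIdeal (RingHom.ker_isMaximal_of_surjective f hf)]

theorem isLocalHom_of_surjective_to_field {A : Type u} {k : Type v} [CommRing A] [IsLocalRing A]
    [Field k] (f : A →+* k) (hf : Function.Surjective f) : IsLocalHom f := by
  refine ⟨fun a ha => ?_⟩
  by_contra h
  exact ha.ne_zero ((map_eq_zero_iff_mem_maximalIdeal f hf a).2 h)

theorem eq_bot_or_eq_maximalIdeal_pow {D : Type u} [CommRing D] [IsDomain D]
    [IsDiscreteValuationRing D] {J : Ideal D} (hJ : J ≤ IsLocalRing.maximalIdeal D) :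
    J = ⊥ ∨ ∃ n : ℕ, 1 ≤ n ∧ J = IsLocalRing.maximalIdeal D ^ n := by
  refine or_iff_not_imp_left.2 fun h => ?_
  obtain ⟨n, rfl⟩ :=
    exists_maximalIdeal_pow_eq_of_principal D (IsPrincipalIdealRing.principal _) J h
  refine ⟨n, Nat.one_le_iff_ne_zero.2 ?_, rfl⟩
  rintro rfl
  rw [pow_zero, Ideal.one_eq_top, top_le_iff] at hJ
  exact Ideal.IsPrime.ne_top' hJ

/-! ### The two parameters of the pullback ring -/

/-- If multiplication by `e` factors through a map `π` onto a discrete valuation ring which sends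
`e` to a uniformizer, then `r e` is a unit times a positive power of `e` whenever `π r ≠ 0`. -/
theorem exists_associated_pow_of_map_irreducible {A : Type u} {D : Type v} [CommRing A] [CommRing D]
    [IsDomain D] [IsDiscreteValuationRing D] (π : A →+* D) (hπ : Function.Surjective π)
    [IsLocalHom π] {e : A} (he : Irreducible (π e)) (hmul : ∀ a b, π a = π b → a * e = b * e)
    {r : A} (hr : π r ≠ 0) : ∃ n : ℕ, Associated (r * e) (e ^ (n + 1)) := by
  obtain ⟨n, u, hu⟩ := IsDiscreteValuationRing.eq_unit_mul_pow_irreducible hr he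
  obtain ⟨w, hw⟩ := hπ u
  have hwu : IsUnit w := isUnit_of_map_unit π w (hw ▸ u.isUnit)
  refine ⟨n, Associated.symm ⟨hwu.unit, ?_⟩⟩
  rw [hmul r (w * e ^ n) (by rw [hu, map_mul, map_pow, hw]), IsUnit.unit_spec]
  ring

section Pullback

variable {R₁ : Type u₁} {R₂ : Type u₂} {k : Type u₃} [CommRing R₁] [CommRing R₂] [Field k]
  {v₁ : R₁ →+* k} {v₂ : R₂ →+* k}

theorem isLocalRing_pullback_of_surjective [IsLocalRing R₁] [IsLocalRing R₂]
    (hv₂ : Function.Surjective v₂) : IsLocalRing (RingHom.pullback v₁ v₂) := by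
  have := isLocalHom_of_surjective_to_field v₂ hv₂
  exact RingHom.isLocalRing_pullback v₁ v₂

/-- A non-zero pseudo-absorbing primary multiplication module over the pullback ring is cyclic:
the two parameters are `(ϖ₁, 0)` and `(0, ϖ₂)`, which generate the two minimal primes. -/
theorem exists_span_singleton_eq_top_of_pullback
    [IsDomain R₁] [IsDiscreteValuationRing R₁] [IsDomain R₂] [IsDiscreteValuationRing R₂]
    (hv₁ : Function.Surjective v₁) (hv₂ : Function.Surjective v₂)
    {S : Type v} [AddCommGroup S] [Module (RingHom.pullback v₁ v₂) S] [Nontrivial S]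
    (hS : IsPseudoAbsorbingPrimaryMultiplication (RingHom.pullback v₁ v₂) S) :
    ∃ x : S, x ≠ 0 ∧ Submodule.span (RingHom.pullback v₁ v₂) {x} = ⊤ := by
  have := isLocalHom_of_surjective_to_field v₁ hv₁
  have := isLocalHom_of_surjective_to_field v₂ hv₂
  have := isLocalRing_pullback_of_surjective (v₁ := v₁) hv₂
  obtain ⟨p₁, hp₁⟩ := IsDiscreteValuationRing.exists_irreducible R₁
  obtain ⟨p₂, hp₂⟩ := IsDiscreteValuationRing.exists_irreducible R₂
  have hv₁0 : ∀ a, v₁ a = 0 ↔ p₁ ∣ a := fun a => by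
    rw [map_eq_zero_iff_mem_maximalIdeal v₁ hv₁, hp₁.maximalIdeal_eq, Ideal.mem_span_singleton]
  have hv₂0 : ∀ a, v₂ a = 0 ↔ p₂ ∣ a := fun a => by
    rw [map_eq_zero_iff_mem_maximalIdeal v₂ hv₂, hp₂.maximalIdeal_eq, Ideal.mem_span_singleton]
  have hs₁ := RingHom.surjective_pullbackFst_of_surjective v₁ v₂ hv₂
  have hs₂ := RingHom.surjective_pullbackSnd_of_surjective v₁ v₂ hv₁
  have hext : ∀ a b : RingHom.pullback v₁ v₂, RingHom.pullbackFst v₁ v₂ a =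
      RingHom.pullbackFst v₁ v₂ b → RingHom.pullbackSnd v₁ v₂ a = RingHom.pullbackSnd v₁ v₂ b →
      a = b := fun a b h h' => Subtype.ext (Prod.ext h h')
  have hcomm : ∀ a : RingHom.pullback v₁ v₂,
      v₁ (RingHom.pullbackFst v₁ v₂ a) = v₂ (RingHom.pullbackSnd v₁ v₂ a) := fun a => a.2
  obtain ⟨e, he₁, he₂⟩ : ∃ e : RingHom.pullback v₁ v₂, RingHom.pullbackFst v₁ v₂ e = p₁ ∧
      RingHom.pullbackSnd v₁ v₂ e = 0 :=
    ⟨⟨(p₁, 0), show v₁ p₁ = v₂ 0 by rw [map_zero, hv₁0]⟩, rfl, rfl⟩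
  obtain ⟨e', he₁', he₂'⟩ : ∃ e : RingHom.pullback v₁ v₂, RingHom.pullbackFst v₁ v₂ e = 0 ∧
      RingHom.pullbackSnd v₁ v₂ e = p₂ :=
    ⟨⟨(0, p₂), show v₁ 0 = v₂ p₂ by rw [map_zero, eq_comm, hv₂0]⟩, rfl, rfl⟩
  have hloc₁ := RingHom.isLocalHom_pullbackFst v₁ v₂
  have hloc₂ := RingHom.isLocalHom_pullbackSnd v₁ v₂
  generalize RingHom.pullbackFst v₁ v₂ = π₁ at *
  generalize RingHom.pullbackSnd v₁ v₂ = π₂ at *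
  have hker₁ : Ideal.span {e'} = RingHom.ker π₁ := by
    refine le_antisymm ((Ideal.span_singleton_le_iff_mem _).2 he₁') fun r hr => ?_
    rw [RingHom.mem_ker] at hr
    obtain ⟨c, hc⟩ := (hv₂0 _).1 (by rw [← hcomm r, hr, map_zero])
    obtain ⟨b, rfl⟩ := hs₂ c
    refine Ideal.mem_span_singleton.2 ⟨b, hext _ _ ?_ ?_⟩
    · rw [hr, map_mul, he₁', zero_mul]
    · rw [hc, map_mul, he₂']
  have hker₂ : Ideal.span {e} = RingHom.ker π₂ := by
    refine le_antisymm ((Ideal.span_singleton_le_iff_mem _).2 he₂) fun r hr => ?_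
    rw [RingHom.mem_ker] at hr
    obtain ⟨c, hc⟩ := (hv₁0 _).1 (by rw [hcomm r, hr, map_zero])
    obtain ⟨b, rfl⟩ := hs₁ c
    refine Ideal.mem_span_singleton.2 ⟨b, hext _ _ ?_ ?_⟩
    · rw [hc, map_mul, he₁]
    · rw [hr, map_mul, he₂, zero_mul]
  refine exists_span_singleton_eq_top (e := e) (e' := e') (hker₂ ▸ RingHom.ker_isPrime π₂)
    (hker₁ ▸ RingHom.ker_isPrime π₁) ?_ ?_ ?_ ?_ hS
  · rw [hker₁, hker₂, eq_bot_iff]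
    rintro r ⟨h₂, h₁⟩
    exact hext r 0 (by rw [h₁, map_zero]) (by rw [h₂, map_zero])
  · intro r hr
    refine exists_associated_pow_of_map_irreducible π₁ hs₁ (he₁ ▸ hp₁) (fun a b hab => ?_)
      (fun h => hr (hker₁ ▸ h))
    refine hext _ _ (by rw [map_mul, map_mul, hab]) ?_
    rw [map_mul, map_mul, he₂, mul_zero, mul_zero]
  · intro r hr
    refine exists_associated_pow_of_map_irreducible π₂ hs₂ (he₂' ▸ hp₂) (fun a b hab => ?_)
      (fun h => hr (hker₂ ▸ h))
    refine hext _ _ ?_ (by rw [map_mul, map_mul, hab])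
    rw [map_mul, map_mul, he₁', mul_zero, mul_zero]
  · refine le_antisymm (fun r hr => ?_) (Ideal.span_le.2 ?_)
    · have h₁ : ¬ IsUnit (π₁ r) := fun h => hr (isUnit_of_map_unit π₁ r h)
      have h₂ : ¬ IsUnit (v₁ (π₁ r)) := fun h => h₁ (isUnit_of_map_unit v₁ _ h)
      have h₃ : v₁ (π₁ r) = 0 := by rwa [isUnit_iff_ne_zero, not_not] at h₂
      obtain ⟨a, ha⟩ := (hv₁0 _).1 h₃
      obtain ⟨b, hb⟩ := (hv₂0 _).1 (hcomm r ▸ h₃)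
      obtain ⟨a, rfl⟩ := hs₁ a
      obtain ⟨b, rfl⟩ := hs₂ b
      refine Ideal.mem_span_pair.2 ⟨a, b, hext _ _ ?_ ?_⟩
      · rw [map_add, map_mul, map_mul, he₁, he₁', mul_zero, add_zero, ha, mul_comm]
      · rw [map_add, map_mul, map_mul, he₂, he₂', mul_zero, zero_add, hb, mul_comm]
    · rintro r (rfl | rfl)
      · exact fun h => not_isUnit_zero (he₂ ▸ h.map π₂)
      · exact fun h => not_isUnit_zero (he₁' ▸ h.map π₁)

/-! ### Annihilators in separated modules -/

/-- The annihilator of a non-zero element of a separated module consists of the pairs in the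
pullback ring whose components lie in given proper ideals. An annihilator of a component of `x` may
be the unit ideal; intersecting it with the maximal ideal does not change the set of pairs. -/
theorem IsSeparatedModule.exists_smul_eq_zero_iff [IsLocalRing R₁] [IsLocalRing R₂]
    (hv₁ : Function.Surjective v₁) (hv₂ : Function.Surjective v₂)
    {S : Type v} [AddCommGroup S] [Module (RingHom.pullback v₁ v₂) S]
    (hS : IsSeparatedModule v₁ v₂ S) {x : S} (hx : x ≠ 0) :
    ∃ (J₁ : Ideal R₁) (J₂ : Ideal R₂), J₁ ≤ IsLocalRing.maximalIdeal R₁ ∧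
      J₂ ≤ IsLocalRing.maximalIdeal R₂ ∧
      ∀ r : RingHom.pullback v₁ v₂, r • x = 0 ↔ r.1.1 ∈ J₁ ∧ r.1.2 ∈ J₂ := by
  obtain ⟨S₁, S₂, _, _, _, _, f, hf, hfs⟩ := hS
  refine ⟨LinearMap.ker (LinearMap.toSpanSingleton R₁ S₁ (f x).1) ⊓ IsLocalRing.maximalIdeal R₁,
    LinearMap.ker (LinearMap.toSpanSingleton R₂ S₂ (f x).2) ⊓ IsLocalRing.maximalIdeal R₂,
    inf_le_right, inf_le_right, fun r => ?_⟩
  have hiff : r • x = 0 ↔ r.1.1 • (f x).1 = 0 ∧ r.1.2 • (f x).2 = 0 := by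
    rw [← map_eq_zero_iff f hf, hfs, Prod.mk_eq_zero]
  simp only [Submodule.mem_inf, LinearMap.mem_ker, LinearMap.toSpanSingleton_apply]
  refine ⟨fun h => ?_, fun h => hiff.2 ⟨h.1.1, h.2.1⟩⟩
  have := isLocalHom_of_surjective_to_field v₁ hv₁
  have := isLocalHom_of_surjective_to_field v₂ hv₂
  have hr : ¬ IsUnit r := fun hu => hx (hu.smul_eq_zero.1 h)
  exact ⟨⟨(hiff.1 h).1, fun hu => hr (isUnit_of_map_unit (RingHom.pullbackFst v₁ v₂) r hu)⟩,
    ⟨(hiff.1 h).2, fun hu => hr (isUnit_of_map_unit (RingHom.pullbackSnd v₁ v₂) r hu)⟩⟩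

/-! ### The modules of the list -/

section PullbackModule

variable {S₁ : Type u₄} {S₂ : Type u₅} [AddCommGroup S₁] [AddCommGroup S₂] [Module R₁ S₁]
  [Module R₂ S₂] {f₁ : S₁ →ₛₗ[v₁] k} {f₂ : S₂ →ₛₗ[v₂] k}

theorem PullbackModule.isSeparatedModule : IsSeparatedModule v₁ v₂ (PullbackModule f₁ f₂) :=
  ⟨ULift.{u₅} S₁, ULift.{u₄} S₂, inferInstance, inferInstance, inferInstance, inferInstance,
    { toFun := fun s => (⟨s.1.1⟩, ⟨s.1.2⟩)
      map_zero' := rfl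
      map_add' := fun _ _ => rfl },
    fun _ _ h => Subtype.ext (Prod.ext (congrArg (fun p => p.1.down) h)
      (congrArg (fun p => p.2.down) h)),
    fun _ _ => rfl⟩

theorem PullbackModule.smul_eq_zero_iff (r : RingHom.pullback v₁ v₂) (s : PullbackModule f₁ f₂) :
    r • s = 0 ↔ r.1.1 • s.1.1 = 0 ∧ r.1.2 • s.1.2 = 0 :=
  Subtype.ext_iff.trans Prod.ext_iff

/-- If `s = (s₁, s₂)` has generators as components and maps to `1` in `k`, then
`(a s₁, b s₂) ∈ (S₁ → k ← S₂)` forces `v₁ a = v₂ b`, so `s` is a generator. -/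
theorem PullbackModule.span_singleton_eq_top {s : PullbackModule f₁ f₂}
    (h₁ : Submodule.span R₁ {s.1.1} = ⊤) (h₂ : Submodule.span R₂ {s.1.2} = ⊤)
    (hs : f₁ s.1.1 = 1) : Submodule.span (RingHom.pullback v₁ v₂) {s} = ⊤ := by
  refine top_le_iff.1 fun t _ => Submodule.mem_span_singleton.2 ?_
  obtain ⟨a, ha⟩ := Submodule.mem_span_singleton.1 (h₁ ▸ Submodule.mem_top : t.1.1 ∈ R₁ ∙ s.1.1)
  obtain ⟨b, hb⟩ := Submodule.mem_span_singleton.1 (h₂ ▸ Submodule.mem_top : t.1.2 ∈ R₂ ∙ s.1.2)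
  have hs₂ : f₂ s.1.2 = 1 := (show f₁ s.1.1 = f₂ s.1.2 from s.2) ▸ hs
  have hab : v₁ a = v₂ b := by
    have ht : f₁ t.1.1 = f₂ t.1.2 := t.2
    rw [← ha, ← hb, map_smulₛₗ, map_smulₛₗ, hs, hs₂] at ht
    simpa using ht
  exact ⟨⟨(a, b), hab⟩, Subtype.ext (Prod.ext ha hb)⟩

theorem PullbackModule.isIndecomposable_isSeparated_isMultiplication
    [IsLocalRing (RingHom.pullback v₁ v₂)] {s : PullbackModule f₁ f₂}
    (h₁ : Submodule.span R₁ {s.1.1} = ⊤) (h₂ : Submodule.span R₂ {s.1.2} = ⊤)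
    (hs : f₁ s.1.1 = 1) :
    IsIndecomposableModule (RingHom.pullback v₁ v₂) (PullbackModule f₁ f₂) ∧
      IsSeparatedModule v₁ v₂ (PullbackModule f₁ f₂) ∧
      IsPseudoAbsorbingPrimaryMultiplication (RingHom.pullback v₁ v₂) (PullbackModule f₁ f₂) := by
  have hspan := PullbackModule.span_singleton_eq_top h₁ h₂ hs
  refine ⟨isIndecomposableModule_of_span_singleton hspan ?_, PullbackModule.isSeparatedModule,
    isPseudoAbsorbingPrimaryMultiplication_of_span_singleton hspan⟩
  rintro rfl
  exact zero_ne_one ((map_zero f₁).symm.trans hs)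

end PullbackModule

theorem isSeparatedModule_pullback : IsSeparatedModule v₁ v₂ (RingHom.pullback v₁ v₂) :=
  ⟨ULift.{u₂} R₁, ULift.{u₁} R₂, inferInstance, inferInstance, inferInstance, inferInstance,
    { toFun := fun s => (⟨s.1.1⟩, ⟨s.1.2⟩)
      map_zero' := rfl
      map_add' := fun _ _ => rfl },
    fun _ _ h => Subtype.ext (Prod.ext (congrArg (fun p => p.1.down) h)
      (congrArg (fun p => p.2.down) h)),
    fun _ _ => rfl⟩

end Pullback

section Residue

variable {A : Type u} {k : Type v} [CommRing A] [Field k]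

theorem semilinearOfRingHom_one (f : A →+* k) : semilinearOfRingHom f 1 = 1 :=
  map_one f

theorem residueMap_mk_one [IsLocalRing A] (f : A →+* k) (hf : Function.Surjective f) (n : ℕ)
    (hn : 1 ≤ n) : residueMap f hf n hn (Submodule.Quotient.mk 1) = 1 :=
  map_one f

theorem span_mk_one_eq_top (J : Ideal A) :
    Submodule.span A {(Submodule.Quotient.mk 1 : A ⧸ J)} = ⊤ := by
  refine top_le_iff.1 fun t _ => Submodule.mem_span_singleton.2 ?_
  obtain ⟨a, rfl⟩ := Submodule.Quotient.mk_surjective J t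
  exact ⟨a, by rw [← Submodule.Quotient.mk_smul, smul_eq_mul, mul_one]⟩

theorem smul_mk_one_eq_zero_iff (J : Ideal A) (a : A) :
    a • (Submodule.Quotient.mk 1 : A ⧸ J) = 0 ↔ a ∈ J := by
  rw [← Submodule.Quotient.mk_smul, smul_eq_mul, mul_one, Submodule.Quotient.mk_eq_zero]

end Residue

/-! ### The classification -/

theorem theorem3p4
    {R₁ : Type u₁} {R₂ : Type u₂} {k : Type u₃}
    [CommRing R₁] [IsDomain R₁] [IsDiscreteValuationRing R₁]
    [CommRing R₂] [IsDomain R₂] [IsDiscreteValuationRing R₂]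
    [Field k]
    (v₁ : R₁ →+* k) (v₂ : R₂ →+* k)
    (hv₁ : Function.Surjective v₁) (hv₂ : Function.Surjective v₂) :
    -- every such module is in the list
    (∀ (S : Type u₄) [AddCommGroup S] [Module (RingHom.pullback v₁ v₂) S],
      IsIndecomposableModule (RingHom.pullback v₁ v₂) S →
      IsSeparatedModule v₁ v₂ S →
      IsPseudoAbsorbingPrimaryMultiplication (RingHom.pullback v₁ v₂) S →
      Nonempty (S ≃ₗ[RingHom.pullback v₁ v₂] RingHom.pullback v₁ v₂) ∨
      (∃ (n m : ℕ) (hn : 1 ≤ n) (hm : 1 ≤ m),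
        Nonempty (S ≃ₗ[RingHom.pullback v₁ v₂]
          PullbackModule (residueMap v₁ hv₁ n hn) (residueMap v₂ hv₂ m hm))) ∨
      (∃ (m : ℕ) (hm : 1 ≤ m),
        Nonempty (S ≃ₗ[RingHom.pullback v₁ v₂]
          PullbackModule (semilinearOfRingHom v₁) (residueMap v₂ hv₂ m hm))) ∨
      (∃ (n : ℕ) (hn : 1 ≤ n),
        Nonempty (S ≃ₗ[RingHom.pullback v₁ v₂]
          PullbackModule (residueMap v₁ hv₁ n hn) (semilinearOfRingHom v₂)))) ∧
    -- every module in the list is of this kind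
    (IsIndecomposableModule (RingHom.pullback v₁ v₂) (RingHom.pullback v₁ v₂) ∧
      IsSeparatedModule v₁ v₂ (RingHom.pullback v₁ v₂) ∧
      IsPseudoAbsorbingPrimaryMultiplication (RingHom.pullback v₁ v₂)
        (RingHom.pullback v₁ v₂)) ∧
    (∀ (n m : ℕ) (hn : 1 ≤ n) (hm : 1 ≤ m),
      IsIndecomposableModule (RingHom.pullback v₁ v₂)
        (PullbackModule (residueMap v₁ hv₁ n hn) (residueMap v₂ hv₂ m hm)) ∧
      IsSeparatedModule v₁ v₂
        (PullbackModule (residueMap v₁ hv₁ n hn) (residueMap v₂ hv₂ m hm)) ∧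
      IsPseudoAbsorbingPrimaryMultiplication (RingHom.pullback v₁ v₂)
        (PullbackModule (residueMap v₁ hv₁ n hn) (residueMap v₂ hv₂ m hm))) ∧
    (∀ (m : ℕ) (hm : 1 ≤ m),
      IsIndecomposableModule (RingHom.pullback v₁ v₂)
        (PullbackModule (semilinearOfRingHom v₁) (residueMap v₂ hv₂ m hm)) ∧
      IsSeparatedModule v₁ v₂
        (PullbackModule (semilinearOfRingHom v₁) (residueMap v₂ hv₂ m hm)) ∧
      IsPseudoAbsorbingPrimaryMultiplication (RingHom.pullback v₁ v₂)
        (PullbackModule (semilinearOfRingHom v₁) (residueMap v₂ hv₂ m hm))) ∧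
    (∀ (n : ℕ) (hn : 1 ≤ n),
      IsIndecomposableModule (RingHom.pullback v₁ v₂)
        (PullbackModule (residueMap v₁ hv₁ n hn) (semilinearOfRingHom v₂)) ∧
      IsSeparatedModule v₁ v₂
        (PullbackModule (residueMap v₁ hv₁ n hn) (semilinearOfRingHom v₂)) ∧
      IsPseudoAbsorbingPrimaryMultiplication (RingHom.pullback v₁ v₂)
        (PullbackModule (residueMap v₁ hv₁ n hn) (semilinearOfRingHom v₂))) := by
  have hlocal := isLocalRing_pullback_of_surjective (v₁ := v₁) hv₂
  have hone : Submodule.span (RingHom.pullback v₁ v₂) {(1 : RingHom.pullback v₁ v₂)} = ⊤ :=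
    Ideal.span_singleton_one
  have hone₁ : Submodule.span R₁ {(1 : R₁)} = ⊤ := Ideal.span_singleton_one
  have hone₂ : Submodule.span R₂ {(1 : R₂)} = ⊤ := Ideal.span_singleton_one
  -- The pair `(1, 1)`, which generates each of the modules in the list.
  let gen₁₂ (n m : ℕ) (hn : 1 ≤ n) (hm : 1 ≤ m) :
      PullbackModule (residueMap v₁ hv₁ n hn) (residueMap v₂ hv₂ m hm) :=
    ⟨(Submodule.Quotient.mk 1, Submodule.Quotient.mk 1),
      (residueMap_mk_one v₁ hv₁ n hn).trans (residueMap_mk_one v₂ hv₂ m hm).symm⟩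
  let gen₂ (m : ℕ) (hm : 1 ≤ m) :
      PullbackModule (semilinearOfRingHom v₁) (residueMap v₂ hv₂ m hm) :=
    ⟨(1, Submodule.Quotient.mk 1),
      (semilinearOfRingHom_one v₁).trans (residueMap_mk_one v₂ hv₂ m hm).symm⟩
  let gen₁ (n : ℕ) (hn : 1 ≤ n) :
      PullbackModule (residueMap v₁ hv₁ n hn) (semilinearOfRingHom v₂) :=
    ⟨(Submodule.Quotient.mk 1, 1),
      (residueMap_mk_one v₁ hv₁ n hn).trans (semilinearOfRingHom_one v₂).symm⟩
  refine ⟨fun S _ _ hind hsep hmul => ?_, ⟨?_, isSeparatedModule_pullback, ?_⟩,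
    fun n m hn hm => ?_, fun m hm => ?_, fun n hn => ?_⟩
  · have := hind.1
    obtain ⟨x, hx0, hx⟩ := exists_span_singleton_eq_top_of_pullback hv₁ hv₂ hmul
    obtain ⟨J₁, J₂, hJ₁, hJ₂, hann⟩ := hsep.exists_smul_eq_zero_iff hv₁ hv₂ hx0
    rcases eq_bot_or_eq_maximalIdeal_pow hJ₁ with rfl | ⟨n, hn, rfl⟩ <;>
      rcases eq_bot_or_eq_maximalIdeal_pow hJ₂ with rfl | ⟨m, hm, rfl⟩
    · refine Or.inl (nonempty_linearEquiv_of_span_singleton hx hone fun r => (hann r).trans ?_)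
      rw [smul_eq_mul, mul_one, Ideal.mem_bot, Ideal.mem_bot, Subtype.ext_iff, Prod.ext_iff]
      rfl
    · refine Or.inr (Or.inr (Or.inl ⟨m, hm, nonempty_linearEquiv_of_span_singleton hx
        (PullbackModule.span_singleton_eq_top (s := gen₂ m hm) hone₁ (span_mk_one_eq_top _)
          (semilinearOfRingHom_one v₁)) fun r => (hann r).trans ?_⟩))
      rw [PullbackModule.smul_eq_zero_iff]
      refine and_congr ?_ (smul_mk_one_eq_zero_iff _ _).symm
      change _ ↔ r.1.1 * 1 = 0
      rw [mul_one, Ideal.mem_bot]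
    · refine Or.inr (Or.inr (Or.inr ⟨n, hn, nonempty_linearEquiv_of_span_singleton hx
        (PullbackModule.span_singleton_eq_top (s := gen₁ n hn) (span_mk_one_eq_top _) hone₂
          (residueMap_mk_one v₁ hv₁ n hn)) fun r => (hann r).trans ?_⟩))
      rw [PullbackModule.smul_eq_zero_iff]
      refine and_congr (smul_mk_one_eq_zero_iff _ _).symm ?_
      change _ ↔ r.1.2 * 1 = 0
      rw [mul_one, Ideal.mem_bot]
    · refine Or.inr (Or.inl ⟨n, m, hn, hm, nonempty_linearEquiv_of_span_singleton hx
        (PullbackModule.span_singleton_eq_top (s := gen₁₂ n m hn hm) (span_mk_one_eq_top _)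
          (span_mk_one_eq_top _) (residueMap_mk_one v₁ hv₁ n hn)) fun r => (hann r).trans ?_⟩)
      rw [PullbackModule.smul_eq_zero_iff]
      exact and_congr (smul_mk_one_eq_zero_iff _ _).symm (smul_mk_one_eq_zero_iff _ _).symm
  · exact isIndecomposableModule_of_span_singleton hone one_ne_zero
  · exact isPseudoAbsorbingPrimaryMultiplication_of_span_singleton hone
  · exact PullbackModule.isIndecomposable_isSeparated_isMultiplication (s := gen₁₂ n m hn hm)
      (span_mk_one_eq_top _) (span_mk_one_eq_top _) (residueMap_mk_one v₁ hv₁ n hn)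
  · exact PullbackModule.isIndecomposable_isSeparated_isMultiplication (s := gen₂ m hm)
      hone₁ (span_mk_one_eq_top _) (semilinearOfRingHom_one v₁)
  · exact PullbackModule.isIndecomposable_isSeparated_isMultiplication (s := gen₁ n hn)
      (span_mk_one_eq_top _) hone₂ (residueMap_mk_one v₁ hv₁ n hn)
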